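/- Let $X$ be a proper CAT(0) space with boundary at infinity $\partial X$ (the set of asymptoty classes of geodesic rays), and give $X\cup\partial X$ the cone topology. Let $G$ be a group of isometries of $X$ that acts cocompactly on $X$ (the translates by $G$ of some compact set cover $X$) and fixes a point $p\in\partial X$. Let $\overline{G}$ be the closure of $G$ in the isometry group of $X$ for the topology of pointwise convergence (so $\overline{G}=G$ if $G$ is closed). Then there exist a geodesic line $R:\mathbf{R}\to X$, a real number $d\ge 0$ and a sequence $(g_n)_{n\in\mathbf{N}}$ of isometries in $\overline{G}$ such that: 1. $R(-\infty)=p$; 2. for every $n$, the line $g_n(R)$ is parallel to $R$ (their images are at finite Hausdorff distance), and the Hausdorff distance between $g_n(R)$ and $R$ is at most $d$; 3. for every $q\in X$, $g_n(q)\to R(+\infty)$ and $g_n^{-1}(q)\to R(-\infty)$ in $X\cup\partial X$ as $n\to\infty$. In particular, if $G$ is closed then all $g_n$ belong to $G$. -/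

import Mathlib

open Set Filter Topology Metric
open scoped NNReal

/-- `c` restricts on `[0, dist x y]` to a geodesic segment from `x` to `y`. Values of `c` outside
this interval are irrelevant. -/
structure IsGeodesicSegment {X : Type*} [MetricSpace X] (c : ℝ → X) (x y : X) : Prop where
  left : c 0 = x
  right : c (dist x y) = y
  dist_eq : ∀ s ∈ Icc 0 (dist x y), ∀ t ∈ Icc 0 (dist x y), dist (c s) (c t) = |s - t|

/-- `X` is a CAT(0) space: it is a geodesic space and its geodesic triangles are not fatter than
their Euclidean comparison triangles. Two sides of a triangle share a vertex `x`; the point at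
distance `s` from `x` on the side `[x, y]` has as comparison point the point `a` of the Euclidean
segment `[x', y']` at distance `s` from `x'`. -/
structure IsCAT0 (X : Type*) [MetricSpace X] : Prop where
  exists_geodesic : ∀ x y : X, ∃ c : ℝ → X, IsGeodesicSegment c x y
  comparison : ∀ (x y z : X) (c₁ c₂ : ℝ → X),
    IsGeodesicSegment c₁ x y → IsGeodesicSegment c₂ x z →
    ∀ x' y' z' : EuclideanSpace ℝ (Fin 2),
      dist x' y' = dist x y → dist x' z' = dist x z → dist y' z' = dist y z →
    ∀ s ∈ Icc 0 (dist x y), ∀ t ∈ Icc 0 (dist x z), ∀ a b : EuclideanSpace ℝ (Fin 2),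
      dist x' a = s → dist a y' = dist x y - s →
      dist x' b = t → dist b z' = dist x z - t →
      dist (c₁ s) (c₂ t) ≤ dist a b

/-- Geodesic rays: isometric embeddings of `[0, ∞)`. -/
structure GeodesicRay (X : Type*) [MetricSpace X] where
  toFun : ℝ≥0 → X
  isometry : Isometry toFun

/-- Geodesic lines: isometric embeddings of `ℝ`. -/
structure GeodesicLine (X : Type*) [MetricSpace X] where
  toFun : ℝ → X
  isometry : Isometry toFun

/-- Two rays are asymptotic if they stay at bounded distance from each other. -/
def GeodesicRay.asymptotic (X : Type*) [MetricSpace X] : Setoid (GeodesicRay X) where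
  r φ ψ := ∃ C : ℝ, ∀ t, dist (φ.toFun t) (ψ.toFun t) ≤ C
  iseqv :=
    { refl := fun φ => ⟨0, fun t => by simp⟩
      symm := fun ⟨C, h⟩ => ⟨C, fun t => by rw [dist_comm]; exact h t⟩
      trans := fun ⟨C, h⟩ ⟨D, k⟩ =>
        ⟨C + D, fun t => (dist_triangle _ _ _).trans (add_le_add (h t) (k t))⟩ }

/-- The boundary at infinity: asymptoty classes of geodesic rays. -/
def Boundary (X : Type*) [MetricSpace X] : Type _ := Quotient (GeodesicRay.asymptotic X)

/-- The endpoint `φ(∞)` of a ray. -/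
def GeodesicRay.endpoint {X : Type*} [MetricSpace X] (φ : GeodesicRay X) : Boundary X :=
  Quotient.mk (GeodesicRay.asymptotic X) φ

/-- The image of a ray under an isometry. -/
def GeodesicRay.map {X : Type*} [MetricSpace X] (g : X ≃ᵢ X) (φ : GeodesicRay X) :
    GeodesicRay X where
  toFun := fun t => g (φ.toFun t)
  isometry := g.isometry.comp φ.isometry

/-- The action of an isometry on the boundary: `g (φ(∞)) = (g ∘ φ)(∞)`. -/
def Boundary.map {X : Type*} [MetricSpace X] (g : X ≃ᵢ X) : Boundary X → Boundary X :=
  Quotient.map (sa := GeodesicRay.asymptotic X) (sb := GeodesicRay.asymptotic X)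
    (GeodesicRay.map g) (fun φ ψ ⟨C, h⟩ => ⟨C, fun t => by
      simpa [GeodesicRay.map, g.isometry.dist_eq] using h t⟩)

/-- The endpoint `R(+∞)` of a line. -/
def GeodesicLine.posEnd {X : Type*} [MetricSpace X] (R : GeodesicLine X) : Boundary X :=
  GeodesicRay.endpoint
    { toFun := fun t => R.toFun (t : ℝ)
      isometry := R.isometry.comp isometry_subtype_coe }

/-- The endpoint `R(-∞)` of a line. -/
def GeodesicLine.negEnd {X : Type*} [MetricSpace X] (R : GeodesicLine X) : Boundary X :=
  GeodesicRay.endpoint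
    { toFun := fun t => R.toFun (-(t : ℝ))
      isometry := R.isometry.comp ((IsometryEquiv.neg ℝ).isometry.comp isometry_subtype_coe) }

/-- The image of a line under an isometry. -/
def GeodesicLine.map {X : Type*} [MetricSpace X] (g : X ≃ᵢ X) (R : GeodesicLine X) :
    GeodesicLine X where
  toFun := fun t => g (R.toFun t)
  isometry := g.isometry.comp R.isometry

/-- Two lines are parallel if their images are at finite Hausdorff distance. -/
def GeodesicLine.Parallel {X : Type*} [MetricSpace X] (R S : GeodesicLine X) : Prop :=
  hausdorffEDist (range R.toFun) (range S.toFun) ≠ ⊤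

/-- The space `X ∪ ∂X`. -/
inductive Bordification (X : Type*) [MetricSpace X] where
  | point (x : X) : Bordification X
  | ideal (ξ : Boundary X) : Bordification X

/-- The basic set `U(φ, r, ε)` of the cone topology: all points of `X ∪ ∂X` outside the closed ball
of radius `r` around `φ(0)` such that the geodesic (segment or ray) from `φ(0)` to that point passes,
at time `r`, within less than `ε` of `φ(r)`. -/
def coneNhd {X : Type*} [MetricSpace X] (φ : GeodesicRay X) (r : ℝ≥0) (ε : ℝ) :
    Set (Bordification X) :=
  {b | match b with
    | .point x => (r : ℝ) < dist (φ.toFun 0) x ∧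
        ∃ c : ℝ → X, IsGeodesicSegment c (φ.toFun 0) x ∧ dist (c r) (φ.toFun r) < ε
    | .ideal ξ => ∃ ψ : GeodesicRay X, ψ.endpoint = ξ ∧ ψ.toFun 0 = φ.toFun 0 ∧
        dist (ψ.toFun r) (φ.toFun r) < ε}

/-- The cone topology on `X ∪ ∂X`, generated by the open sets of `X` and the sets `U(φ, r, ε)`. -/
instance Bordification.coneTopology (X : Type*) [MetricSpace X] :
    TopologicalSpace (Bordification X) :=
  TopologicalSpace.generateFrom
    ({U | ∃ V : Set X, IsOpen V ∧ U = Bordification.point '' V} ∪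
      {U | ∃ (φ : GeodesicRay X) (r : ℝ≥0) (ε : ℝ), 0 < r ∧ 0 < ε ∧ U = coneNhd φ r ε})

/-- The topology of pointwise convergence on the isometry group (for isometries it is the same as
the compact-open topology). -/
instance isometryGroupTopology (X : Type*) [MetricSpace X] : TopologicalSpace (X ≃ᵢ X) :=
  TopologicalSpace.induced (fun g : X ≃ᵢ X => (g : X → X)) Pi.topologicalSpace

/-- `G` acts cocompactly: the translates by `G` of some compact set cover `X`. -/
def ActsCocompactly {X : Type*} [MetricSpace X] (G : Subgroup (X ≃ᵢ X)) : Prop :=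
  ∃ K : Set X, IsCompact K ∧ (⋃ g ∈ G, (g : X → X) '' K) = univ

/-!
The line and the isometries are limits obtained by conjugating with a sequence that follows a ray
to `p`.

Let `r` be a ray with endpoint `p`. Cocompactness gives `a k ∈ G` and a constant `D` such that
`dist (a k (r 0)) (r k) ≤ D`. As `a n` fixes `p`, the ray `(a n)⁻¹ ∘ r` is asymptotic to `r`, and
convexity of the metric makes the distance between asymptotic rays at equal times at most the
distance of their origins (`GeodesicRay.dist_le_of_endpoint_eq`). Hence the following limits along a
nonprincipal ultrafilter exist, everything in sight being bounded and `X` proper: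

* `M s = lim (a k)⁻¹ (r (k - s))`, a line with `M (-∞) = p`;
* `g n = lim (a k)⁻¹ (a n)⁻¹ (a k)`, an isometry in the closure of `G`.

For large `k` the points `(a n)⁻¹ (r (k - s))` and `r (k - s - n)` are at distance at most `D`, since
they lie on the asymptotic rays `t ↦ (a n)⁻¹ (r (n + t))` and `t ↦ r t` at equal times. Applying
`(a k)⁻¹` and passing to the limit gives `dist (g n (M s)) (M (s + n)) ≤ D` for all `s`. So `g n M`
is parallel to `M` at Hausdorff distance at most `D`, while `g n q` and `(g n)⁻¹ q` stay at bounded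
distance from `M n` and `M (-n)`, which forces their convergence to the endpoints of `M`
(`GeodesicRay.tendsto_endpoint`).
-/

/-! ### Comparison triangles and convexity of the metric -/

/-- Three numbers satisfying the triangle inequalities are the side lengths of a triangle in the
Euclidean plane with one vertex at the origin. -/
theorem exists_euclidean_triangle {a b c : ℝ} (ha : 0 ≤ a) (hb : 0 ≤ b) (hc : 0 ≤ c)
    (habc : a ≤ b + c) (hbac : b ≤ a + c) (hcab : c ≤ a + b) :
    ∃ y z : EuclideanSpace ℝ (Fin 2), ‖y‖ = a ∧ ‖z‖ = b ∧ dist y z = c := by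
  rcases ha.eq_or_lt with rfl | ha'
  · obtain rfl : b = c := by linarith
    refine ⟨0, !₂[b, 0], by simp, ?_, ?_⟩ <;>
      simp [EuclideanSpace.norm_eq, Real.sqrt_sq_eq_abs, abs_of_nonneg hb]
  · set u : ℝ := (a ^ 2 + b ^ 2 - c ^ 2) / (2 * a) with hu
    have hua : 2 * a * u = a ^ 2 + b ^ 2 - c ^ 2 := by rw [hu]; field_simp
    have hub : u ^ 2 ≤ b ^ 2 := by
      apply sq_le_sq'
      · have : 0 ≤ 2 * a * (u + b) := by nlinarith
        nlinarith [nonneg_of_mul_nonneg_right this (by positivity : (0 : ℝ) < 2 * a)]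
      · have : 0 ≤ 2 * a * (b - u) := by nlinarith
        nlinarith [nonneg_of_mul_nonneg_right this (by positivity : (0 : ℝ) < 2 * a)]
    have hv : Real.sqrt (b ^ 2 - u ^ 2) ^ 2 = b ^ 2 - u ^ 2 := Real.sq_sqrt (by linarith)
    refine ⟨!₂[a, 0], !₂[u, Real.sqrt (b ^ 2 - u ^ 2)], ?_, ?_, ?_⟩
    · simp [EuclideanSpace.norm_eq, Real.sqrt_sq_eq_abs, abs_of_nonneg ha]
    · rw [EuclideanSpace.norm_eq, Real.sqrt_eq_iff_mul_self_eq (by positivity) hb]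
      simp [hv]
      ring
    · rw [EuclideanSpace.dist_eq, Real.sqrt_eq_iff_mul_self_eq (by positivity) hc]
      simp [Real.dist_eq, hv]
      linarith

theorem IsGeodesicSegment.reverse {X : Type*} [MetricSpace X] {c : ℝ → X} {x y : X}
    (h : IsGeodesicSegment c x y) : IsGeodesicSegment (fun s => c (dist x y - s)) y x where
  left := by simpa using h.right
  right := by simpa [dist_comm y x] using h.left
  dist_eq := by
    intro s hs t ht
    rw [dist_comm y x] at hs ht
    rw [h.dist_eq _ ⟨by linarith [hs.2], by linarith [hs.1]⟩ _
      ⟨by linarith [ht.2], by linarith [ht.1]⟩, abs_sub_comm s t]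
    congr 1
    ring

/-- Two sides of a triangle issuing from the same vertex, each divided in the ratio `l`. -/
theorem IsCAT0.dist_le_of_common_left {X : Type*} [MetricSpace X] (hX : IsCAT0 X) {x y z : X}
    {c₁ c₂ : ℝ → X} (h₁ : IsGeodesicSegment c₁ x y) (h₂ : IsGeodesicSegment c₂ x z) {l : ℝ}
    (hl₀ : 0 ≤ l) (hl₁ : l ≤ 1) :
    dist (c₁ (l * dist x y)) (c₂ (l * dist x z)) ≤ l * dist y z := by
  obtain ⟨y', z', hy, hz, hyz⟩ := exists_euclidean_triangle (dist_nonneg (x := x) (y := y))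
    (dist_nonneg (x := x) (y := z)) (dist_nonneg (x := y) (y := z))
    (by rw [dist_comm y z]; exact dist_triangle x z y) (dist_triangle x y z)
    (dist_triangle_left y z x)
  have key : ∀ w : EuclideanSpace ℝ (Fin 2), dist (l • w) w = ‖w‖ - l * ‖w‖ := by
    intro w
    have : l • w - w = (l - 1) • w := by module
    rw [dist_eq_norm, this, norm_smul, Real.norm_eq_abs, abs_of_nonpos (by linarith)]
    ring
  have := hX.comparison x y z c₁ c₂ h₁ h₂ 0 y' z' (by simpa using hy) (by simpa using hz) hyz
    (l * dist x y) ⟨by positivity, mul_le_of_le_one_left dist_nonneg hl₁⟩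
    (l * dist x z) ⟨by positivity, mul_le_of_le_one_left dist_nonneg hl₁⟩ (l • y') (l • z')
    (by rw [dist_zero_left, norm_smul, hy, Real.norm_of_nonneg hl₀]) (by rw [key, hy])
    (by rw [dist_zero_left, norm_smul, hz, Real.norm_of_nonneg hl₀]) (by rw [key, hz])
  rwa [dist_smul₀, Real.norm_of_nonneg hl₀, hyz] at this

/-- The distance between two geodesics parametrized proportionally to arc length is convex. -/
theorem IsCAT0.dist_le_convex {X : Type*} [MetricSpace X] (hX : IsCAT0 X) {x y x' y' : X}
    {c₁ c₂ : ℝ → X} (h₁ : IsGeodesicSegment c₁ x y) (h₂ : IsGeodesicSegment c₂ x' y') {l : ℝ}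
    (hl₀ : 0 ≤ l) (hl₁ : l ≤ 1) :
    dist (c₁ (l * dist x y)) (c₂ (l * dist x' y')) ≤ (1 - l) * dist x x' + l * dist y y' := by
  -- Compare both sides with the diagonal from `x` to `y'`.
  obtain ⟨c, hc⟩ := hX.exists_geodesic x y'
  have e₁ := hX.dist_le_of_common_left h₁ hc hl₀ hl₁
  have e₂ := hX.dist_le_of_common_left hc.reverse h₂.reverse (l := 1 - l)
    (by linarith) (by linarith)
  rw [dist_comm y' x, dist_comm y' x'] at e₂
  simp only [one_sub_mul, sub_sub_cancel] at e₂
  linarith [dist_triangle (c₁ (l * dist x y)) (c (l * dist x y')) (c₂ (l * dist x' y'))]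

/-! ### Geodesic rays -/

theorem GeodesicRay.dist_toNNReal {X : Type*} [MetricSpace X] (φ : GeodesicRay X) {s t : ℝ}
    (hs : 0 ≤ s) (ht : 0 ≤ t) :
    dist (φ.toFun s.toNNReal) (φ.toFun t.toNNReal) = |s - t| := by
  rw [φ.isometry.dist_eq, NNReal.dist_eq, Real.coe_toNNReal _ hs, Real.coe_toNNReal _ ht]

theorem GeodesicRay.dist_zero {X : Type*} [MetricSpace X] (φ : GeodesicRay X) (t : ℝ≥0) :
    dist (φ.toFun 0) (φ.toFun t) = t := by
  rw [φ.isometry.dist_eq, NNReal.dist_eq]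
  simp

theorem GeodesicRay.isGeodesicSegment {X : Type*} [MetricSpace X] (φ : GeodesicRay X) (T : ℝ≥0) :
    IsGeodesicSegment (fun s => φ.toFun s.toNNReal) (φ.toFun 0) (φ.toFun T) where
  left := by simp
  right := by simp [φ.dist_zero]
  dist_eq := fun _ hs _ ht => φ.dist_toNNReal hs.1 ht.1

/-- The subray of `φ` that starts at `φ a`. -/
def GeodesicRay.shift {X : Type*} [MetricSpace X] (φ : GeodesicRay X) (a : ℝ≥0) :
    GeodesicRay X where
  toFun := fun t => φ.toFun (a + t)
  isometry := φ.isometry.comp (Isometry.of_dist_eq fun s t => by simp [NNReal.dist_eq])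

theorem GeodesicRay.endpoint_eq_iff {X : Type*} [MetricSpace X] {φ ψ : GeodesicRay X} :
    φ.endpoint = ψ.endpoint ↔ ∃ C : ℝ, ∀ t, dist (φ.toFun t) (ψ.toFun t) ≤ C :=
  Quotient.eq (r := GeodesicRay.asymptotic X)

theorem GeodesicRay.endpoint_shift {X : Type*} [MetricSpace X] (φ : GeodesicRay X) (a : ℝ≥0) :
    (φ.shift a).endpoint = φ.endpoint :=
  endpoint_eq_iff.2 ⟨a, fun t => by simp [shift, φ.isometry.dist_eq, NNReal.dist_eq]⟩

/-- The distance between asymptotic rays at equal times is bounded and convex, hence it is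
nonincreasing. -/
theorem GeodesicRay.dist_le_of_endpoint_eq {X : Type*} [MetricSpace X] (hX : IsCAT0 X)
    {φ ψ : GeodesicRay X} (h : φ.endpoint = ψ.endpoint) (t : ℝ≥0) :
    dist (φ.toFun t) (ψ.toFun t) ≤ dist (φ.toFun 0) (ψ.toFun 0) := by
  obtain ⟨C, hC⟩ := endpoint_eq_iff.1 h
  have hC₀ : 0 ≤ C := dist_nonneg.trans (hC 0)
  have key : ∀ᶠ T : ℝ in atTop,
      dist (φ.toFun t) (ψ.toFun t) ≤ dist (φ.toFun 0) (ψ.toFun 0) + t * C / T := by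
    filter_upwards [eventually_ge_atTop (t : ℝ), eventually_gt_atTop 0] with T hT hT₀
    have hl₁ : (t : ℝ) / T ≤ 1 := (div_le_one hT₀).2 hT
    have := hX.dist_le_convex (φ.isGeodesicSegment T.toNNReal) (ψ.isGeodesicSegment T.toNNReal)
      (l := t / T) (by positivity) hl₁
    rw [φ.dist_zero, ψ.dist_zero, Real.coe_toNNReal _ hT₀.le, div_mul_cancel₀ _ hT₀.ne',
      Real.toNNReal_coe] at this
    have h₁ : (t : ℝ) / T * dist (φ.toFun T.toNNReal) (ψ.toFun T.toNNReal) ≤ t / T * C :=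
      mul_le_mul_of_nonneg_left (hC _) (by positivity)
    have h₂ : (1 - (t : ℝ) / T) * dist (φ.toFun 0) (ψ.toFun 0) ≤ dist (φ.toFun 0) (ψ.toFun 0) :=
      mul_le_of_le_one_left dist_nonneg (by linarith [show 0 ≤ (t : ℝ) / T by positivity])
    calc _ ≤ _ := this
      _ ≤ _ := add_le_add h₂ h₁
      _ = _ := by ring
  have lim : Tendsto (fun T : ℝ => dist (φ.toFun 0) (ψ.toFun 0) + t * C / T) atTop
      (𝓝 (dist (φ.toFun 0) (ψ.toFun 0) + 0)) :=
    tendsto_const_nhds.add (tendsto_const_nhds.div_atTop tendsto_id)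
  rw [add_zero] at lim
  exact ge_of_tendsto lim key

/-- A sequence that stays at bounded distance from `φ n` converges to `φ (∞)` in the cone
topology. -/
theorem GeodesicRay.tendsto_endpoint {X : Type*} [MetricSpace X] (hX : IsCAT0 X)
    (φ : GeodesicRay X) {y : ℕ → X} {C : ℝ} (hy : ∀ n : ℕ, dist (y n) (φ.toFun n) ≤ C) :
    Tendsto (fun n => Bordification.point (y n)) atTop
      (𝓝 (Bordification.ideal φ.endpoint)) := by
  rw [TopologicalSpace.tendsto_nhds_generateFrom_iff]
  rintro _ (⟨V, -, rfl⟩ | ⟨χ, r, ε, hr, hε, rfl⟩) hmem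
  · simp at hmem
  obtain ⟨ψ, hψ, hψ₀, hψr⟩ := hmem
  obtain ⟨C', hC'⟩ := endpoint_eq_iff.1 hψ
  -- `B` bounds the distance from `y n` to the point at time `n` of the ray from `χ 0`.
  set B : ℝ := C + C' with hB
  have hyψ : ∀ n : ℕ, dist (y n) (ψ.toFun n) ≤ B := fun n => by
    linarith [dist_triangle_right (y n) (ψ.toFun n) (φ.toFun n), hy n, hC' n]
  have hB₀ : 0 ≤ B := dist_nonneg.trans (hyψ 0)
  have hlen : ∀ n : ℕ, |dist (χ.toFun 0) (y n) - n| ≤ B := by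
    intro n
    have h := ψ.dist_zero n
    rw [hψ₀] at h
    have h' := hyψ n
    rw [abs_le]
    simp only [NNReal.coe_natCast] at h
    constructor
    · linarith [dist_triangle (χ.toFun 0) (y n) (ψ.toFun n)]
    · linarith [dist_triangle_right (χ.toFun 0) (y n) (ψ.toFun n)]
  have hlim : Tendsto (fun n : ℕ => dist (χ.toFun 0) (y n)) atTop atTop := by
    refine tendsto_atTop_mono (fun n => ?_)
      (tendsto_atTop_add_const_right atTop (-B) (tendsto_natCast_atTop_atTop (R := ℝ)))
    linarith [(abs_le.1 (hlen n)).1]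
  have hsmall : Tendsto (fun n : ℕ => 2 * r * B / dist (χ.toFun 0) (y n)) atTop (𝓝 0) :=
    tendsto_const_nhds.div_atTop hlim
  filter_upwards [hlim.eventually_gt_atTop (r : ℝ),
    hsmall.eventually_lt_const (sub_pos.2 hψr)] with n hn hn'
  refine ⟨hn, ?_⟩
  obtain ⟨c, hc⟩ := hX.exists_geodesic (χ.toFun 0) (y n)
  refine ⟨c, hc, ?_⟩
  set l := dist (χ.toFun 0) (y n) with hl
  have hl₀ : 0 < l := r.coe_nonneg.trans_lt hn
  have hseg := ψ.isGeodesicSegment n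
  rw [hψ₀] at hseg
  have e₁ := hX.dist_le_of_common_left hc hseg (l := r / l) (by positivity)
    ((div_le_one hl₀).2 hn.le)
  have hd : dist (χ.toFun 0) (ψ.toFun n) = n := by rw [← hψ₀, ψ.dist_zero]; simp
  rw [← hl, hd, div_mul_cancel₀ _ hl₀.ne'] at e₁
  have e₂ : dist (ψ.toFun (r / l * n : ℝ).toNNReal) (ψ.toFun r) ≤ r / l * B := by
    have := ψ.dist_toNNReal (s := r / l * n) (t := r) (by positivity) r.coe_nonneg
    rw [Real.toNNReal_coe] at this
    have e : (r : ℝ) / l * n - r = r / l * (n - l) := by field_simp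
    rw [this, e, abs_mul, abs_of_nonneg (by positivity), abs_sub_comm]
    exact mul_le_mul_of_nonneg_left (hlen n) (by positivity)
  have e₃ : (r : ℝ) / l * dist (y n) (ψ.toFun n) ≤ r / l * B :=
    mul_le_mul_of_nonneg_left (hyψ n) (by positivity)
  have e₄ : (r : ℝ) / l * B + r / l * B = 2 * r * B / l := by ring
  linarith [dist_triangle4 (c r) (ψ.toFun (r / l * n : ℝ).toNNReal) (ψ.toFun r) (χ.toFun r)]

/-! ### Limits along an ultrafilter -/

theorem exists_tendsto_ultrafilter_of_dist_le {X ι : Type*} [MetricSpace X] [ProperSpace X]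
    (U : Ultrafilter ι) {f : ι → X} {x : X} {B : ℝ} (h : ∀ᶠ i in U, dist (f i) x ≤ B) :
    ∃ y, Tendsto f U (𝓝 y) := by
  obtain ⟨y, -, hy⟩ := (isCompact_closedBall x B).ultrafilter_le_nhds (U.map f)
    (le_principal_iff.2 h)
  exact ⟨y, hy⟩

/-- Isometries of a proper space that move a point by a bounded amount have a pointwise limit along
every ultrafilter, and this limit is a bijective isometry. -/
theorem exists_isometryEquiv_tendsto {X ι : Type*} [MetricSpace X] [ProperSpace X]
    (U : Ultrafilter ι) (f : ι → X ≃ᵢ X) {x₀ : X} {B : ℝ} (h : ∀ i, dist (f i x₀) x₀ ≤ B) :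
    ∃ g : X ≃ᵢ X, ∀ x, Tendsto (fun i => f i x) U (𝓝 (g x)) := by
  have hsymm : ∀ i, dist ((f i).symm x₀) x₀ ≤ B := fun i => by
    rw [← (f i).isometry.dist_eq, (f i).apply_symm_apply, dist_comm]
    exact h i
  have bound : ∀ f : ι → X ≃ᵢ X, (∀ i, dist (f i x₀) x₀ ≤ B) →
      ∀ x, ∃ y, Tendsto (fun i => f i x) U (𝓝 y) := fun f h x =>
    exists_tendsto_ultrafilter_of_dist_le U (x := x₀) (B := dist x x₀ + B) <|
      Eventually.of_forall fun i => by
        have := dist_triangle (f i x) (f i x₀) x₀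
        rw [(f i).isometry.dist_eq] at this
        linarith [h i]
  choose F hF using bound f h
  choose H hH using bound (fun i => (f i).symm) hsymm
  have hFH : ∀ x, F (H x) = x := fun x => by
    refine tendsto_nhds_unique (hF (H x)) (tendsto_iff_dist_tendsto_zero.2 ?_)
    refine (tendsto_iff_dist_tendsto_zero.1 (hH x)).congr fun i => ?_
    rw [← (f i).isometry.dist_eq, (f i).apply_symm_apply, dist_comm]
  have hisom : Isometry F := Isometry.of_dist_eq fun x y =>
    tendsto_nhds_unique ((hF x).dist (hF y)) (by simp [(f _).isometry.dist_eq])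
  exact ⟨IsometryEquiv.mk' F H hFH hisom, hF⟩

/-! ### The line and the isometries -/

/-- A cocompact group moves a given point uniformly close to every point. -/
theorem ActsCocompactly.exists_dist_le {X : Type*} [MetricSpace X] {G : Subgroup (X ≃ᵢ X)}
    (hG : ActsCocompactly G) (x₀ : X) : ∃ D : ℝ, ∀ y : X, ∃ g ∈ G, dist (g x₀) y ≤ D := by
  obtain ⟨K, hK, hcov⟩ := hG
  have hex : ∀ y : X, ∃ g ∈ G, ∃ k ∈ K, g k = y := fun y => by
    have := hcov.symm ▸ mem_univ y
    simpa using this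
  obtain ⟨g₀, hg₀, k₀, hk₀, rfl⟩ := hex x₀
  refine ⟨diam K, fun y => ?_⟩
  obtain ⟨g, hg, k, hk, rfl⟩ := hex y
  refine ⟨g * g₀⁻¹, G.mul_mem hg (G.inv_mem hg₀), ?_⟩
  have : (g * g₀⁻¹) (g₀ k₀) = g k₀ := by
    rw [← IsometryEquiv.mul_apply, inv_mul_cancel_right]
  rw [this, g.isometry.dist_eq]
  exact dist_le_diam_of_mem hK.isBounded hk₀ hk

/-- A line and isometries that move it along itself up to a bounded error. -/
theorem exists_line_coarsely_translated {X : Type*} [MetricSpace X] [ProperSpace X]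
    (hX : IsCAT0 X) (G : Subgroup (X ≃ᵢ X)) (hG : ActsCocompactly G)
    (p : Boundary X) (hp : ∀ g ∈ G, Boundary.map g p = p) :
    ∃ (R : GeodesicLine X) (d : ℝ) (g : ℕ → (X ≃ᵢ X)),
      (∀ n, g n ∈ closure (G : Set (X ≃ᵢ X))) ∧ R.negEnd = p ∧
      ∀ (n : ℕ) (s : ℝ), dist (g n (R.toFun s)) (R.toFun (s + n)) ≤ d := by
  obtain ⟨r, rfl⟩ : ∃ r : GeodesicRay X, r.endpoint = p := Quotient.exists_rep p
  have hfix : ∀ g ∈ G, (r.map g).endpoint = r.endpoint := hp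
  obtain ⟨D, hD⟩ := hG.exists_dist_le (r.toFun 0)
  choose a haG ha using fun k : ℕ => hD (r.toFun k)
  have ha' : ∀ k : ℕ, dist ((a k)⁻¹ (r.toFun k)) (r.toFun 0) ≤ D := fun k => by
    rw [← (a k).isometry.dist_eq, IsometryEquiv.apply_inv_self, dist_comm]
    exact ha k
  have hfollow : ∀ (k : ℕ) (t : ℝ≥0), dist ((a k)⁻¹ (r.toFun (k + t))) (r.toFun t) ≤ D := by
    intro k t
    have hend : ((r.shift k).map (a k)⁻¹).endpoint = r.endpoint := by
      have h₁ := (r.map (a k)⁻¹).endpoint_shift k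
      rw [hfix _ (G.inv_mem (haG k))] at h₁
      exact h₁
    refine (GeodesicRay.dist_le_of_endpoint_eq hX hend t).trans ?_
    simpa [GeodesicRay.map, GeodesicRay.shift] using ha' k
  let U : Ultrafilter ℕ := hyperfilter ℕ
  have hU : (U : Filter ℕ) ≤ atTop := Nat.hyperfilter_le_atTop
  have hge : ∀ s : ℝ, ∀ᶠ k : ℕ in U, s ≤ k := fun s =>
    hU (tendsto_natCast_atTop_atTop.eventually_ge_atTop s)
  -- The line, as the limit of the rays `r` based at time `k` and brought back near `r 0`.
  have hM : ∀ s : ℝ, ∃ y, Tendsto (fun k : ℕ => (a k)⁻¹ (r.toFun (k - s).toNNReal)) U (𝓝 y) := by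
    intro s
    refine exists_tendsto_ultrafilter_of_dist_le U (x := r.toFun 0) (B := |s| + D) ?_
    filter_upwards [hge s] with k hk
    have h₁ := dist_triangle ((a k)⁻¹ (r.toFun (k - s).toNNReal)) ((a k)⁻¹ (r.toFun k))
      (r.toFun 0)
    have h₂ := r.dist_toNNReal (s := k - s) (t := k) (by linarith) k.cast_nonneg
    rw [Real.toNNReal_natCast, sub_sub_cancel_left, abs_neg] at h₂
    rw [(a k)⁻¹.isometry.dist_eq, h₂] at h₁
    linarith [ha' k]
  choose M hM using hM
  have hMisom : Isometry M := Isometry.of_dist_eq fun s t => by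
    refine tendsto_nhds_unique ((hM s).dist (hM t)) (tendsto_const_nhds.congr' ?_)
    filter_upwards [hge s, hge t] with k hs ht
    rw [(a k)⁻¹.isometry.dist_eq, r.dist_toNNReal (by linarith) (by linarith),
      sub_sub_sub_cancel_left, Real.dist_eq, abs_sub_comm]
  have hg : ∀ n : ℕ, ∃ g : X ≃ᵢ X, ∀ x,
      Tendsto (fun k : ℕ => ((a k)⁻¹ * (a n)⁻¹ * a k) x) U (𝓝 (g x)) := by
    intro n
    refine exists_isometryEquiv_tendsto U _ (x₀ := r.toFun 0)
      (B := 2 * D + dist ((a n)⁻¹ (r.toFun 0)) (r.toFun 0)) fun k => ?_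
    have h₁ : dist ((a n)⁻¹ (r.toFun k)) (r.toFun k) ≤ dist ((a n)⁻¹ (r.toFun 0)) (r.toFun 0) :=
      GeodesicRay.dist_le_of_endpoint_eq hX (hfix _ (G.inv_mem (haG n))) k
    rw [← (a k).isometry.dist_eq, IsometryEquiv.mul_apply, IsometryEquiv.mul_apply,
      IsometryEquiv.apply_inv_self]
    have h₂ := dist_triangle4 ((a n)⁻¹ (a k (r.toFun 0))) ((a n)⁻¹ (r.toFun k)) (r.toFun k)
      (a k (r.toFun 0))
    rw [(a n)⁻¹.isometry.dist_eq, dist_comm (r.toFun k)] at h₂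
    linarith [ha k]
  choose g hg using hg
  refine ⟨⟨M, hMisom⟩, D, g, fun n => ?_, ?_, fun n s => ?_⟩
  · refine mem_closure_of_tendsto (b := (U : Filter ℕ))
      (f := fun k => (a k)⁻¹ * (a n)⁻¹ * a k) ?_ (Eventually.of_forall fun k => ?_)
    · rw [nhds_induced, tendsto_comap_iff, tendsto_pi_nhds]
      exact hg n
    · exact G.mul_mem (G.mul_mem (G.inv_mem (haG k)) (G.inv_mem (haG n))) (haG k)
  · refine GeodesicRay.endpoint_eq_iff.2 ⟨D, fun t => ?_⟩
    refine le_of_tendsto ((hM (-t)).dist tendsto_const_nhds) (Eventually.of_forall fun k => ?_)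
    have : ((k : ℝ) - -t).toNNReal = k + t := by
      rw [sub_neg_eq_add, Real.toNNReal_add k.cast_nonneg t.coe_nonneg, Real.toNNReal_natCast,
        Real.toNNReal_coe]
    simpa only [this] using hfollow k t
  · -- `M s` may be replaced by the points `(a k)⁻¹ (r (k - s))` that converge to it.
    have h₁ : Tendsto (fun k : ℕ => (a k)⁻¹ ((a n)⁻¹ (r.toFun (k - s).toNNReal))) U
        (𝓝 (g n (M s))) := by
      refine (hg n (M s)).congr_dist ?_
      refine (tendsto_iff_dist_tendsto_zero.1 (hM s)).congr fun k => ?_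
      rw [IsometryEquiv.mul_apply, IsometryEquiv.mul_apply, (a k)⁻¹.isometry.dist_eq,
        (a n)⁻¹.isometry.dist_eq, ← (a k).isometry.dist_eq, IsometryEquiv.apply_inv_self,
        dist_comm]
    refine le_of_tendsto (h₁.dist (hM (s + n))) ?_
    filter_upwards [hge (s + n)] with k hk
    rw [(a k)⁻¹.isometry.dist_eq]
    have : ((k : ℝ) - s).toNNReal = n + (k - (s + n)).toNNReal := by
      rw [← Real.toNNReal_natCast n, ← Real.toNNReal_add n.cast_nonneg (by linarith)]
      congr 1
      ring
    rw [this]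
    exact hfollow n _

theorem mainTheorem10 {X : Type*} [MetricSpace X] [ProperSpace X] (hX : IsCAT0 X)
    (G : Subgroup (X ≃ᵢ X)) (hG : ActsCocompactly G)
    (p : Boundary X) (hp : ∀ g ∈ G, Boundary.map g p = p) :
    ∃ (R : GeodesicLine X) (d : ℝ) (g : ℕ → (X ≃ᵢ X)),
      0 ≤ d ∧
      (∀ n, g n ∈ closure (G : Set (X ≃ᵢ X))) ∧
      R.negEnd = p ∧
      (∀ n, (R.map (g n)).Parallel R ∧
        hausdorffDist (range (R.map (g n)).toFun) (range R.toFun) ≤ d) ∧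
      (∀ q : X,
        Tendsto (fun n => Bordification.point (g n q)) atTop (𝓝 (Bordification.ideal R.posEnd)) ∧
        Tendsto (fun n => Bordification.point ((g n).symm q)) atTop
          (𝓝 (Bordification.ideal R.negEnd))) := by
  obtain ⟨R, d, g, hgG, hR, hg⟩ := exists_line_coarsely_translated hX G hG p hp
  have hd : 0 ≤ d := dist_nonneg.trans (hg 0 0)
  refine ⟨R, d, g, hd, hgG, hR, fun n => ?_, fun q => ⟨?_, ?_⟩⟩
  · have h₁ : ∀ x ∈ range (R.map (g n)).toFun, ∃ y ∈ range R.toFun, dist x y ≤ d := by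
      rintro _ ⟨s, rfl⟩
      exact ⟨_, mem_range_self (s + n), hg n s⟩
    have h₂ : ∀ x ∈ range R.toFun, ∃ y ∈ range (R.map (g n)).toFun, dist x y ≤ d := by
      rintro _ ⟨s, rfl⟩
      refine ⟨_, mem_range_self (s - n), ?_⟩
      have := hg n (s - n)
      rwa [sub_add_cancel, dist_comm] at this
    refine ⟨ne_top_of_le_ne_top ENNReal.ofReal_ne_top
      (hausdorffEDist_le_of_mem_edist (r := ENNReal.ofReal d) ?_ ?_),
      hausdorffDist_le_of_mem_dist hd h₁ h₂⟩
    · intro x hx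
      obtain ⟨y, hy, hxy⟩ := h₁ x hx
      exact ⟨y, hy, by rw [edist_dist]; exact ENNReal.ofReal_le_ofReal hxy⟩
    · intro x hx
      obtain ⟨y, hy, hxy⟩ := h₂ x hx
      exact ⟨y, hy, by rw [edist_dist]; exact ENNReal.ofReal_le_ofReal hxy⟩
  · refine GeodesicRay.tendsto_endpoint hX _ (C := dist q (R.toFun 0) + d) fun n => ?_
    have h₁ := dist_triangle (g n q) (g n (R.toFun 0)) (R.toFun n)
    have h₂ := hg n 0
    rw [zero_add] at h₂
    rw [(g n).isometry.dist_eq] at h₁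
    simpa using h₁.trans (add_le_add_right h₂ _)
  · refine GeodesicRay.tendsto_endpoint hX _ (C := dist q (R.toFun 0) + d) fun n => ?_
    have h₁ := hg n (-n)
    rw [neg_add_cancel, dist_comm] at h₁
    have h₂ : dist ((g n).symm q) (R.toFun (-n)) = dist q (g n (R.toFun (-n))) := by
      rw [← (g n).isometry.dist_eq, (g n).apply_symm_apply]
    have h₃ := dist_triangle q (R.toFun 0) (g n (R.toFun (-n)))
    simpa using h₂.trans_le (h₃.trans (add_le_add_right h₁ _))
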